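/- Let $\mathcal G=(\mathcal V,\mathcal E,w)$ be a finite undirected weighted graph with weights $w(i,j)=w(j,i)\ge 0$, where $\mathcal E$ is the set of pairs of positive weight. Let $\mathsf L=\mathsf D-\mathsf W$ be its Laplacian, where $\mathsf W=[w(i,j)]_{i,j}$ and $\mathsf D$ is the diagonal matrix with $\mathsf D_{ii}=\sum_j w(i,j)$. Let $q_i\ge 0$ for $i\in\mathcal V$ be such that the graph obtained from $\mathcal G$ by adding a node $\Gamma$, joined to each $i\in\mathcal V$ by an edge of weight $q_i$ (no edge if $q_i=0$), is connected. Put $\mathsf Q=\mathrm{diag}(q_i)$ and $\mathsf K=(\mathsf L+\mathsf Q)^{-1}\mathsf Q$. A rooted spanning forest $\phi$ of $\mathcal G$ is a set of disjoint trees in $\mathcal G$ covering $\mathcal V$, each with one distinguished vertex (its root) towards which its edges are directed; $\rho(\phi)$ denotes the set of roots and $r_\phi(i)$ the root of the tree containing $i$. Let $\Phi_Q$ be a random rooted spanning forest with $$\mathbb P(\Phi_Q=\phi)\ \propto\ \prod_{i\in\rho(\phi)}q_i\prod_{(i,j)\in\phi}w(i,j).$$ For $y\in\mathbb R^{\mathcal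 V}$ let $\hat x=\mathsf K y=(\mathsf L+\mathsf Q)^{-1}\mathsf Q y$ and $\tilde x(i)=y(r_{\Phi_Q}(i))$ for $i\in\mathcal V$. Then $\mathsf L+\mathsf Q$ is invertible, $\tilde x$ is an unbiased estimator of $\hat x$, that is, $$\mathbb E[\tilde x]=\hat x,$$ and, with $\|x\|_{\mathsf Q}^2=x^\top\mathsf Q x$, its weighted expected error is $$\mathbb E\big(\|\hat x-\tilde x\|_{\mathsf Q}^2\big)=\sum_{i\in\mathcal V}q_i\,\mathrm{Var}(\tilde x(i))=y^\top(\mathsf Q-\mathsf K^\top\mathsf Q\mathsf K)y.$$ -/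

import Mathlib

open MeasureTheory ProbabilityTheory
open scoped Matrix

/-- An undirected weighted graph on the vertex set `V`: a symmetric nonnegative weight function.
The edges are the pairs of positive weight. -/
structure WeightedGraph (V : Type*) where
  /-- the weight function -/
  w : V → V → ℝ
  w_nonneg : ∀ i j, 0 ≤ w i j
  w_symm : ∀ i j, w i j = w j i

namespace WeightedGraph

/-- The underlying simple graph (loops are forgotten). -/
def toSimpleGraph {V : Type*} (G : WeightedGraph V) : SimpleGraph V where
  Adj i j := i ≠ j ∧ 0 < G.w i j
  symm := ⟨fun i j h => ⟨h.1.symm, G.w_symm i j ▸ h.2⟩⟩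
  loopless := ⟨fun _ h => h.1 rfl⟩

/-- The graph extended by one node `Γ`, here `none`, joined to each `i : V` with weight `q i`. -/
def extend {V : Type*} (G : WeightedGraph V) (q : V → ℝ) (hq : ∀ i, 0 ≤ q i) :
    WeightedGraph (Option V) where
  w a b :=
    match a, b with
    | some i, some j => G.w i j
    | some i, none => q i
    | none, some j => q j
    | none, none => 0
  w_nonneg a b := by
    rcases a with _ | i <;> rcases b with _ | j
    · exact le_refl 0
    · exact hq j
    · exact hq i
    · exact G.w_nonneg i j
  w_symm a b := by
    rcases a with _ | i <;> rcases b with _ | j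
    · rfl
    · rfl
    · rfl
    · exact G.w_symm i j

/-- The weighted adjacency matrix `W`. -/
def adjacency {V : Type*} (G : WeightedGraph V) : Matrix V V ℝ :=
  Matrix.of G.w

/-- The degree matrix `D`. Pairs that are not edges have weight `0`, so the sum over the
neighbours of `i` is the sum over all vertices. -/
def degreeMatrix {V : Type*} [Fintype V] [DecidableEq V] (G : WeightedGraph V) : Matrix V V ℝ :=
  Matrix.diagonal fun i => ∑ j, G.w i j

/-- The graph Laplacian `L = D - W`. -/
def laplacian {V : Type*} [Fintype V] [DecidableEq V] (G : WeightedGraph V) : Matrix V V ℝ :=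
  G.degreeMatrix - G.adjacency

/-- The matrix `K = (L + Q)⁻¹ Q` with `Q = diag q`. -/
noncomputable def kernelMatrix {V : Type*} [Fintype V] [DecidableEq V] (G : WeightedGraph V)
    (q : V → ℝ) : Matrix V V ℝ :=
  (G.laplacian + Matrix.diagonal q)⁻¹ * Matrix.diagonal q

/-- The Tikhonov regularization `x̂ = K y = (L + Q)⁻¹ Q y` of the measurements `y`. -/
noncomputable def xHat {V : Type*} [Fintype V] [DecidableEq V] (G : WeightedGraph V)
    (q y : V → ℝ) : V → ℝ :=
  G.kernelMatrix q *ᵥ y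

/-- A rooted spanning forest of `G`: a set of edges of `G`, every one directed towards the root
of its tree. A vertex has at most one outgoing edge, the roots are the vertices without an outgoing
edge, and from every vertex the directed edges lead to a root; in particular there is no cycle,
and every tree has exactly one root. -/
structure RootedSpanningForest {V : Type*} (G : WeightedGraph V) where
  /-- the directed edges -/
  edges : Finset (V × V)
  edge_pos : ∀ i j, (i, j) ∈ edges → 0 < G.w i j
  out_unique : ∀ i j k, (i, j) ∈ edges → (i, k) ∈ edges → j = k
  exists_root : ∀ i, ∃ r, (∀ j, (r, j) ∉ edges) ∧
    Relation.ReflTransGen (fun a b => (a, b) ∈ edges) i r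

namespace RootedSpanningForest

/-- There are finitely many forests; every event about the forest is measurable. -/
instance {V : Type*} (G : WeightedGraph V) : MeasurableSpace G.RootedSpanningForest := ⊤

/-- The root set `ρ(φ)`. -/
noncomputable def roots {V : Type*} [Fintype V] {G : WeightedGraph V}
    (φ : G.RootedSpanningForest) : Finset V :=
  open Classical in Finset.univ.filter fun r => ∀ j, (r, j) ∉ φ.edges

/-- The root function `r_φ`: the root to which the directed edges lead from `i`. -/
noncomputable def rootOf {V : Type*} {G : WeightedGraph V}
    (φ : G.RootedSpanningForest) (i : V) : V :=
  Classical.choose (φ.exists_root i)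

/-- The root reached from `i` is unique, so `rootOf` involves no choice. -/
theorem eq_rootOf {V : Type*} {G : WeightedGraph V} (φ : G.RootedSpanningForest) (i r : V)
    (hr : ∀ j, (r, j) ∉ φ.edges)
    (h : Relation.ReflTransGen (fun a b => (a, b) ∈ φ.edges) i r) : r = φ.rootOf i := by
  obtain ⟨hs, h'⟩ := Classical.choose_spec (φ.exists_root i)
  change r = Classical.choose (φ.exists_root i)
  generalize Classical.choose (φ.exists_root i) = s at hs h'
  induction h using Relation.ReflTransGen.head_induction_on with
  | refl =>
    rcases Relation.ReflTransGen.cases_head h' with e | ⟨c, hc, _⟩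
    · exact e
    · exact absurd hc (hr c)
  | head hab _ ih =>
    rcases Relation.ReflTransGen.cases_head h' with e | ⟨c, hc, hcs⟩
    · exact absurd (e ▸ hab) (hs _)
    · exact ih (φ.out_unique _ _ _ hab hc ▸ hcs)

/-- The weight `∏_{i ∈ ρ(φ)} q_i ∏_{(i,j) ∈ φ} w(i,j)`. -/
noncomputable def weight {V : Type*} [Fintype V] {G : WeightedGraph V} (q : V → ℝ)
    (φ : G.RootedSpanningForest) : ℝ :=
  (∏ i ∈ φ.roots, q i) * ∏ e ∈ φ.edges, G.w e.1 e.2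

end RootedSpanningForest

/-- `Φ` is a random spanning forest `Φ_Q` of `G` on the probability space `(Ω, μ)`: a random
variable with `P(Φ = φ) ∝ ∏_{i ∈ ρ(φ)} q_i ∏_{(i,j) ∈ φ} w(i,j)`. -/
structure IsRandomSpanningForest {V Ω : Type*} [Fintype V] [MeasurableSpace Ω]
    (G : WeightedGraph V) (q : V → ℝ) (Φ : Ω → G.RootedSpanningForest) (μ : Measure Ω) :
    Prop where
  measurable : Measurable Φ
  law : ∃ c : ℝ, ∀ φ, μ.real (Φ ⁻¹' {φ}) = c * φ.weight q

/-- The estimator `x̃(i) = y(r_Φ(i))`. -/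
noncomputable def xTilde {V : Type*} {G : WeightedGraph V} (y : V → ℝ)
    (φ : G.RootedSpanningForest) : V → ℝ :=
  fun i => y (φ.rootOf i)

end WeightedGraph

/-- The squared weighted norm `‖x‖²_Q = xᵀ Q x` with `Q = diag q`. -/
def weightedNormSq {V : Type*} [Fintype V] [DecidableEq V] (q x : V → ℝ) : ℝ :=
  x ⬝ᵥ (Matrix.diagonal q *ᵥ x)

/-! Everything follows from one identity: for every `h`, the vector `x i = E[h(r_Φ(i))]` solves `(L
+ Q) x = Q h`, that is, `x = K h` (`integral_rootOf`). To get it, encode a forest by its parent map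
and pair it with a further out-neighbour `a` of `i`, where `none` stands for `Γ`. Swapping `a` with
the current parent of `i`, unless this closes a cycle, is a weight-preserving involution
(`exchange`), and it turns the root of `i` into the root seen from `a`. Summing over all pairs gives
the harmonic equation at `i` (`sum_weight_root`). Taking `h = y` gives unbiasedness; `h = y²` gives
the second moments, hence the variances `K(y²) - (K y)²`. In the sum weighted by `q`, the first term
becomes `yᵀ Q y` because `qᵀ K = qᵀ`, which holds since `L` is symmetric and kills constants. -/

namespace ParentMap

/-! ### Parent maps and their roots. -/

variable {V : Type*}

/-- `Reaches f u v`: following the parent map `f` from `u` leads to `v`. -/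
abbrev Reaches (f : V → Option V) : V → V → Prop :=
  Relation.ReflTransGen fun a b => f a = some b

/-- From every vertex the parent map leads to a vertex without a parent. -/
def Acyclic (f : V → Option V) : Prop :=
  ∀ v, ∃ r, f r = none ∧ Reaches f v r

theorem Reaches.eq_of_root {f : V → Option V} {v r s : V} (hr : f r = none) (hs : f s = none)
    (h : Reaches f v r) (h' : Reaches f v s) : r = s := by
  induction h using Relation.ReflTransGen.head_induction_on with
  | refl =>
    rcases Relation.ReflTransGen.cases_head h' with e | ⟨c, hc, _⟩
    · exact e
    · simp [hr] at hc
  | head hab _ ih =>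
    rcases Relation.ReflTransGen.cases_head h' with e | ⟨c, hc, hcs⟩
    · subst e; simp [hs] at hab
    · rw [hab] at hc
      cases hc
      exact ih hcs

/-- A cycle through `i` also passes through the parent of `i`. Moving along the path from `i` to its
root, the cycle would reach a vertex without a parent. -/
theorem Acyclic.not_reaches_of_eq_some {f : V → Option V} (hf : Acyclic f) {i v : V}
    (h : f i = some v) : ¬ Reaches f v i := by
  obtain ⟨r, hr, hir⟩ := hf i
  induction hir using Relation.ReflTransGen.head_induction_on generalizing v with
  | refl => simp [hr] at h
  | @head a b hab _ ih =>
    rw [h] at hab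
    cases hab
    intro hva
    rcases Relation.ReflTransGen.cases_head hva with e | ⟨c, hc, hca⟩
    · subst e
      exact ih h Relation.ReflTransGen.refl
    · exact ih hc (hca.tail h)

/-- The root reached from `v`. -/
noncomputable def root {f : V → Option V} (hf : Acyclic f) (v : V) : V :=
  Classical.choose (hf v)

theorem root_eq_none {f : V → Option V} (hf : Acyclic f) (v : V) : f (root hf v) = none :=
  (Classical.choose_spec (hf v)).1

theorem reaches_root {f : V → Option V} (hf : Acyclic f) (v : V) : Reaches f v (root hf v) :=
  (Classical.choose_spec (hf v)).2

theorem eq_root {f : V → Option V} (hf : Acyclic f) {v r : V} (hr : f r = none)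
    (h : Reaches f v r) : r = root hf v :=
  h.eq_of_root hr (root_eq_none hf v) (reaches_root hf v)

theorem root_eq_of_reaches {f : V → Option V} (hf : Acyclic f) {u v : V} (h : Reaches f u v) :
    root hf u = root hf v :=
  (eq_root hf (root_eq_none hf v) (h.trans (reaches_root hf v))).symm

/-- The root reached from `i` when its parent is redirected to `a`. -/
noncomputable def rootVia {f : V → Option V} (hf : Acyclic f) (i : V) (a : Option V) : V :=
  a.elim i (root hf)

/-! ### Redirecting the parent of one vertex. -/

section Update

variable [DecidableEq V]

theorem Reaches.update {f : V → Option V} {v i : V} (a : Option V) (h : Reaches f v i) :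
    Reaches (Function.update f i a) v i := by
  induction h using Relation.ReflTransGen.head_induction_on with
  | refl => exact Relation.ReflTransGen.refl
  | @head u b hub _ ih =>
    by_cases hu : u = i
    · subst hu; exact Relation.ReflTransGen.refl
    · exact Relation.ReflTransGen.head (by rwa [Function.update_of_ne hu]) ih

/-- A path to `i` can be stopped at its first visit to `i`, so it never uses the parent of `i`. This
is what makes an exchange at `i` reversible. -/
theorem reaches_update_iff {f : V → Option V} {v i : V} (a : Option V) :
    Reaches (Function.update f i a) v i ↔ Reaches f v i := by
  refine ⟨fun h => ?_, fun h => h.update a⟩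
  have := h.update (f i)
  rwa [Function.update_idem, Function.update_eq_self] at this

theorem Reaches.update_of_not_reaches {f : V → Option V} {u v i : V} (a : Option V)
    (h : Reaches f u v) (hu : ¬ Reaches f u i) : Reaches (Function.update f i a) u v := by
  induction h using Relation.ReflTransGen.head_induction_on with
  | refl => exact Relation.ReflTransGen.refl
  | @head u b hub _ ih =>
    have hne : u ≠ i := fun e => hu (e ▸ Relation.ReflTransGen.refl)
    exact Relation.ReflTransGen.head (by rwa [Function.update_of_ne hne])
      (ih fun hb => hu (hb.head hub))

theorem root_update_aux {f : V → Option V} (hf : Acyclic f) {i v : V} (a : Option V)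
    (hv : ¬ Reaches f v i) : Function.update f i a (root hf v) = none ∧
      Reaches (Function.update f i a) v (root hf v) := by
  refine ⟨?_, (reaches_root hf v).update_of_not_reaches a hv⟩
  have hne : root hf v ≠ i := fun e => hv (by simpa only [e] using reaches_root hf v)
  rw [Function.update_of_ne hne, root_eq_none hf v]

theorem rootVia_update_aux {f : V → Option V} (hf : Acyclic f) {i : V} {a : Option V}
    (ha : ∀ v, a = some v → ¬ Reaches f v i) :
    Function.update f i a (rootVia hf i a) = none ∧
      Reaches (Function.update f i a) i (rootVia hf i a) := by
  rcases a with _ | v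
  · exact ⟨by simp [rootVia], Relation.ReflTransGen.refl⟩
  · obtain ⟨h₁, h₂⟩ := root_update_aux hf (some v) (ha v rfl)
    exact ⟨h₁, h₂.head (by simp)⟩

theorem Acyclic.update {f : V → Option V} (hf : Acyclic f) {i : V} {a : Option V}
    (ha : ∀ v, a = some v → ¬ Reaches f v i) : Acyclic (Function.update f i a) := by
  intro v
  by_cases hv : Reaches f v i
  · obtain ⟨h₁, h₂⟩ := rootVia_update_aux hf ha
    exact ⟨_, h₁, (hv.update a).trans h₂⟩
  · exact ⟨_, root_update_aux hf a hv⟩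

theorem root_update_self {f : V → Option V} (hf : Acyclic f) {i : V} {a : Option V}
    (ha : ∀ v, a = some v → ¬ Reaches f v i) :
    root (hf.update ha) i = rootVia hf i a := by
  obtain ⟨h₁, h₂⟩ := rootVia_update_aux hf ha
  exact (eq_root _ h₁ h₂).symm

theorem Acyclic.not_reaches_update {f : V → Option V} (hf : Acyclic f) (i : V) (a : Option V) :
    ∀ v, f i = some v → ¬ Reaches (Function.update f i a) v i := fun _ hv h =>
  hf.not_reaches_of_eq_some hv ((reaches_update_iff a).1 h)

end Update

/-! ### The exchange involution and the harmonic equation. -/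

section Exchange

variable [DecidableEq V]

open Classical in
/-- Exchange the parent of `i` with a further out-neighbour `a` of `i`, unless this closes
a cycle. -/
noncomputable def exchange (i : V) (p : Option V × {f : V → Option V // Acyclic f}) :
    Option V × {f : V → Option V // Acyclic f} :=
  if h : ∀ v, p.1 = some v → ¬ Reaches p.2.1 v i then
    (p.2.1 i, ⟨Function.update p.2.1 i p.1, p.2.2.update h⟩)
  else p

theorem exchange_involutive (i : V) : Function.Involutive (exchange (V := V) i) := by
  rintro ⟨a, f, hf⟩
  by_cases h : ∀ v, a = some v → ¬ Reaches f v i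
  · have h' := hf.not_reaches_update i a
    have e : exchange i (a, ⟨f, hf⟩) = (f i, ⟨Function.update f i a, hf.update h⟩) := dif_pos h
    rw [e, exchange, dif_pos h']
    simp
  · have e : exchange i (a, ⟨f, hf⟩) = (a, ⟨f, hf⟩) := dif_neg h
    rw [e, e]

/-- If the exchange is refused, then `a = some v` with `v` leading to `i`. So `v` and `i` lie in one
tree and already share their root. -/
theorem root_exchange (i : V) (p : Option V × {f : V → Option V // Acyclic f}) :
    root (exchange i p).2.2 i = rootVia p.2.2 i p.1 := by
  obtain ⟨a, f, hf⟩ := p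
  by_cases h : ∀ v, a = some v → ¬ Reaches f v i
  · have e : exchange i (a, ⟨f, hf⟩) = (f i, ⟨Function.update f i a, hf.update h⟩) := dif_pos h
    rw [e]
    exact root_update_self hf h
  · have e : exchange i (a, ⟨f, hf⟩) = (a, ⟨f, hf⟩) := dif_neg h
    rw [e]
    push Not at h
    obtain ⟨v, rfl, hv⟩ := h
    exact (root_eq_of_reaches hf hv).symm

variable [Fintype V] {R : Type*} [CommSemiring R]

/-- Only the factors `w i a` and `w i (f i)` trade places; the other vertices keep their parents. -/
theorem weight_exchange (w : V → Option V → R) (i : V)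
    (p : Option V × {f : V → Option V // Acyclic f}) :
    w i (exchange i p).1 * ∏ v, w v ((exchange i p).2.1 v) = w i p.1 * ∏ v, w v (p.2.1 v) := by
  obtain ⟨a, f, hf⟩ := p
  by_cases h : ∀ v, a = some v → ¬ Reaches f v i
  · have e : exchange i (a, ⟨f, hf⟩) = (f i, ⟨Function.update f i a, hf.update h⟩) := dif_pos h
    rw [e]
    simp only
    rw [← Finset.mul_prod_erase _ _ (Finset.mem_univ i),
      ← Finset.mul_prod_erase _ (fun v => w v (f v)) (Finset.mem_univ i),
      Function.update_self, mul_left_comm]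
    congr 2
    refine Finset.prod_congr rfl fun v hv => ?_
    rw [Function.update_of_ne (Finset.ne_of_mem_erase hv)]
  · have e : exchange i (a, ⟨f, hf⟩) = (a, ⟨f, hf⟩) := dif_neg h
    rw [e]

open Classical in
/-- The sum of `h` at the root of `i`, over all acyclic parent maps with weights `w`, satisfies
the harmonic equation at `i`. -/
theorem sum_weight_root (w : V → Option V → R) (h : V → R) (i : V) :
    (∑ a, w i a) * ∑ f : {f : V → Option V // Acyclic f}, (∏ v, w v (f.1 v)) * h (root f.2 i)
      = ∑ a, w i a * ∑ f : {f : V → Option V // Acyclic f},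
          (∏ v, w v (f.1 v)) * h (rootVia f.2 i a) := by
  simp_rw [Finset.sum_mul, Finset.mul_sum, ← mul_assoc]
  rw [← Fintype.sum_prod_type' (f := fun a (f : {f : V → Option V // Acyclic f}) =>
      w i a * (∏ v, w v (f.1 v)) * h (root f.2 i)),
    ← Fintype.sum_prod_type' (f := fun a (f : {f : V → Option V // Acyclic f}) =>
      w i a * (∏ v, w v (f.1 v)) * h (rootVia f.2 i a)),
    -- Only the left-hand sum is reindexed; the two exchange lemmas then make it agree with the
    -- right-hand one term by term.
    ← Equiv.sum_comp (exchange_involutive i).toPerm]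
  refine Finset.sum_congr rfl fun p _ => ?_
  simp only [Function.Involutive.coe_toPerm]
  rw [weight_exchange, root_exchange]

end Exchange

end ParentMap

namespace WeightedGraph

variable {V : Type*}

/-! ### Forests as acyclic parent maps. -/

namespace RootedSpanningForest

variable {G : WeightedGraph V}

theorem edges_injective : Function.Injective (edges (G := G)) := by
  rintro ⟨⟩ ⟨⟩ h
  cases h
  rfl

instance [Finite V] : Finite G.RootedSpanningForest := by
  have := Fintype.ofFinite V
  classical exact Finite.of_injective _ edges_injective

noncomputable instance [Finite V] : Fintype G.RootedSpanningForest := Fintype.ofFinite _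

open Classical in
/-- The parent map of a forest: the head of the outgoing edge, and `none` at the roots. -/
noncomputable def parent (φ : G.RootedSpanningForest) (v : V) : Option V :=
  if h : ∃ j, (v, j) ∈ φ.edges then some h.choose else none

theorem parent_eq_some_iff (φ : G.RootedSpanningForest) {v j : V} :
    φ.parent v = some j ↔ (v, j) ∈ φ.edges := by
  unfold parent
  split_ifs with h
  · rw [Option.some_inj]
    exact ⟨fun e => e ▸ h.choose_spec, fun hj => φ.out_unique _ _ _ h.choose_spec hj⟩
  · simpa using fun hj => h ⟨j, hj⟩

theorem parent_eq_none_iff (φ : G.RootedSpanningForest) {v : V} :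
    φ.parent v = none ↔ ∀ j, (v, j) ∉ φ.edges := by
  simp [Option.eq_none_iff_forall_ne_some, parent_eq_some_iff]

theorem acyclic_parent (φ : G.RootedSpanningForest) : ParentMap.Acyclic φ.parent := by
  intro v
  simpa only [ParentMap.Reaches, parent_eq_some_iff, parent_eq_none_iff] using φ.exists_root v

theorem root_parent (φ : G.RootedSpanningForest) (v : V) :
    ParentMap.root φ.acyclic_parent v = φ.rootOf v := by
  apply φ.eq_rootOf
  · exact φ.parent_eq_none_iff.1 (ParentMap.root_eq_none _ v)
  · simpa only [ParentMap.Reaches, parent_eq_some_iff] using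
      ParentMap.reaches_root φ.acyclic_parent v

theorem parent_injective : Function.Injective (parent (G := G)) := by
  intro φ ψ h
  apply edges_injective
  ext ⟨v, j⟩
  rw [← parent_eq_some_iff, ← parent_eq_some_iff, h]

variable [Fintype V]

/-- The forest of an acyclic parent map along edges of `G`. -/
noncomputable def ofParent (f : V → Option V) (hf : ParentMap.Acyclic f)
    (hw : ∀ i j, f i = some j → 0 < G.w i j) : G.RootedSpanningForest where
  edges := open Classical in Finset.univ.filter fun e => f e.1 = some e.2
  edge_pos i j h := hw i j (by simpa using h)
  out_unique i j k hj hk := by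
    simp only [Finset.mem_filter, Finset.mem_univ, true_and] at hj hk
    exact Option.some_injective _ (hj.symm.trans hk)
  exists_root i := by
    simpa only [Finset.mem_filter, Finset.mem_univ, true_and, Option.eq_none_iff_forall_ne_some,
      ne_eq] using hf i

theorem parent_ofParent (f : V → Option V) (hf : ParentMap.Acyclic f)
    (hw : ∀ i j, f i = some j → 0 < G.w i j) : (ofParent f hf hw).parent = f := by
  ext v j
  simp [parent_eq_some_iff, ofParent]

theorem weight_eq_prod_parent (q : V → ℝ) (φ : G.RootedSpanningForest) :
    φ.weight q = ∏ v, (φ.parent v).elim (q v) (G.w v) := by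
  classical
  have hroots : φ.roots = Finset.univ.filter fun v => φ.parent v = none := by
    ext v
    simp [roots, parent_eq_none_iff]
  rw [weight, hroots, ← Finset.prod_filter_mul_prod_filter_not Finset.univ
    (fun v => φ.parent v = none)]
  congr 1
  · refine Finset.prod_congr rfl fun v hv => ?_
    rw [(Finset.mem_filter.1 hv).2, Option.elim_none]
  · refine Finset.prod_bij (fun e _ => e.1) ?_ ?_ ?_ ?_
    · rintro ⟨v, j⟩ he
      simp [φ.parent_eq_some_iff.2 he]
    · rintro ⟨v, j⟩ hj ⟨u, k⟩ hk (rfl : v = u)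
      rw [φ.out_unique _ _ _ hj hk]
    · intro v hv
      obtain ⟨j, hj⟩ := Option.ne_none_iff_exists'.1 (Finset.mem_filter.1 hv).2
      exact ⟨(v, j), φ.parent_eq_some_iff.1 hj, rfl⟩
    · rintro ⟨v, j⟩ he
      rw [φ.parent_eq_some_iff.2 he, Option.elim_some]

-- The acyclic parent maps that do not come from a forest of `G` use some pair of weight zero, so
-- the sum may run over all of them. The exchange can then ignore which pairs are edges.
open Classical in
theorem sum_weight_mul_rootOf (q h : V → ℝ) (i : V) :
    ∑ φ : G.RootedSpanningForest, φ.weight q * h (φ.rootOf i)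
      = ∑ f : {f : V → Option V // ParentMap.Acyclic f},
          (∏ v, (f.1 v).elim (q v) (G.w v)) * h (ParentMap.root f.2 i) := by
  refine Finset.sum_of_injOn (fun φ => ⟨φ.parent, φ.acyclic_parent⟩) ?_ ?_ ?_ ?_
  · intro φ _ ψ _ e
    exact parent_injective (congrArg Subtype.val e)
  · simp
  · rintro ⟨f, hf⟩ - hnot
    rw [mul_eq_zero]
    left
    by_contra hne
    rw [← ne_eq, Finset.prod_ne_zero_iff] at hne
    refine hnot ⟨ofParent f hf fun v j hj => ?_, by simp, Subtype.ext (parent_ofParent f hf _)⟩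
    have : (f v).elim (q v) (G.w v) ≠ 0 := hne v (Finset.mem_univ v)
    rw [hj] at this
    exact lt_of_le_of_ne (G.w_nonneg v j) this.symm
  · intro φ _
    rw [weight_eq_prod_parent, root_parent]

/-- The total weight of the forests, with `h` evaluated at the root of `i`, solves the
Laplace equation with boundary values `h`. -/
theorem sum_weight_mul_rootOf_eq (q h : V → ℝ) (i : V) :
    (q i + ∑ k, G.w i k) * ∑ φ : G.RootedSpanningForest, φ.weight q * h (φ.rootOf i)
      = q i * (h i * ∑ φ : G.RootedSpanningForest, φ.weight q)
        + ∑ k, G.w i k * ∑ φ : G.RootedSpanningForest, φ.weight q * h (φ.rootOf k) := by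
  classical
  have key := ParentMap.sum_weight_root (fun v a => a.elim (q v) (G.w v)) h i
  -- Redirecting `i` to `none` makes `i` its own root, so that term is `h i` times the total weight,
  -- which is the case `h = 1`.
  have hone := sum_weight_mul_rootOf (G := G) q (fun _ => 1) i
  simp only [mul_one] at hone
  simp only [Fintype.sum_option, Option.elim_none, Option.elim_some, ParentMap.rootVia] at key
  simp only [sum_weight_mul_rootOf, hone]
  rw [key, Finset.mul_sum Finset.univ _ (h i)]
  simp only [mul_comm (h i)]

end RootedSpanningForest

/-! ### Moments of functions of the forest, and linear algebra of `L + Q`. -/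

variable [Fintype V]

theorem IsRandomSpanningForest.memLp_comp {Ω : Type*} [MeasurableSpace Ω] {μ : Measure Ω}
    [IsProbabilityMeasure μ] {G : WeightedGraph V} {q : V → ℝ} {Φ : Ω → G.RootedSpanningForest}
    (hΦ : G.IsRandomSpanningForest q Φ μ) (g : G.RootedSpanningForest → ℝ) (p : ENNReal) :
    MemLp (fun ω => g (Φ ω)) p μ := by
  have := Measure.isProbabilityMeasure_map (μ := μ) hΦ.measurable.aemeasurable
  exact MemLp.comp_of_map (MemLp.of_discrete (f := g)) hΦ.measurable.aemeasurable

variable [DecidableEq V]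

theorem laplacian_add_diagonal_mulVec (G : WeightedGraph V) (q x : V → ℝ) (i : V) :
    ((G.laplacian + Matrix.diagonal q) *ᵥ x) i
      = (q i + ∑ k, G.w i k) * x i - ∑ k, G.w i k * x k := by
  rw [laplacian, degreeMatrix, adjacency, Matrix.add_mulVec, Matrix.sub_mulVec]
  simp only [Pi.add_apply, Pi.sub_apply, Matrix.mulVec_diagonal]
  simp only [Matrix.mulVec, dotProduct, Matrix.of_apply]
  ring

theorem transpose_laplacian_add_diagonal (G : WeightedGraph V) (q : V → ℝ) :
    (G.laplacian + Matrix.diagonal q)ᵀ = G.laplacian + Matrix.diagonal q := by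
  have : G.adjacencyᵀ = G.adjacency := by
    ext i j
    exact G.w_symm j i
  simp [laplacian, degreeMatrix, this]

/-- The double sum meets each unordered pair twice, hence the factor `2`. -/
theorem dotProduct_laplacian_add_diagonal (G : WeightedGraph V) (q x : V → ℝ) :
    2 * (x ⬝ᵥ ((G.laplacian + Matrix.diagonal q) *ᵥ x))
      = ∑ i, ∑ j, G.w i j * (x i - x j) ^ 2 + 2 * ∑ i, q i * x i ^ 2 := by
  have hsymm : ∑ i, ∑ j, G.w i j * x j ^ 2 = ∑ i, ∑ j, G.w i j * x i ^ 2 := by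
    rw [Finset.sum_comm]
    simp only [G.w_symm]
  have hexp : ∑ i, ∑ j, G.w i j * (x i - x j) ^ 2 = ∑ i, ∑ j, G.w i j * x i ^ 2
      + ∑ i, ∑ j, G.w i j * x j ^ 2 - 2 * ∑ i, ∑ j, x i * (G.w i j * x j) := by
    simp only [Finset.mul_sum, ← Finset.sum_add_distrib, ← Finset.sum_sub_distrib]
    exact Finset.sum_congr rfl fun i _ => Finset.sum_congr rfl fun j _ => by ring
  have hdot : x ⬝ᵥ ((G.laplacian + Matrix.diagonal q) *ᵥ x) = ∑ i, q i * x i ^ 2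
      + ∑ i, ∑ j, G.w i j * x i ^ 2 - ∑ i, ∑ j, x i * (G.w i j * x j) := by
    simp only [dotProduct, laplacian_add_diagonal_mulVec, ← Finset.mul_sum, ← Finset.sum_mul,
      ← Finset.sum_add_distrib, ← Finset.sum_sub_distrib]
    exact Finset.sum_congr rfl fun i _ => by ring
  rw [hdot, hexp, hsymm]
  ring

/-- For `x` in the kernel the quadratic form vanishes, and so does each of its nonnegative terms.
Hence `x`, extended by `0` at `Γ`, is constant along the edges of a connected graph. -/
theorem isUnit_laplacian_add_diagonal (G : WeightedGraph V) (q : V → ℝ) (hq : ∀ i, 0 ≤ q i)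
    (hconn : (G.extend q hq).toSimpleGraph.Connected) :
    IsUnit (G.laplacian + Matrix.diagonal q) := by
  rw [← Matrix.mulVec_injective_iff_isUnit]
  refine (injective_iff_map_eq_zero (G.laplacian + Matrix.diagonal q).mulVecLin).2 fun x hx => ?_
  rw [Matrix.mulVecLin_apply] at hx
  have hquad := dotProduct_laplacian_add_diagonal G q x
  rw [hx, dotProduct_zero, mul_zero] at hquad
  have hn₁ : ∀ i, 0 ≤ ∑ j, G.w i j * (x i - x j) ^ 2 := fun i =>
    Finset.sum_nonneg fun j _ => mul_nonneg (G.w_nonneg i j) (sq_nonneg _)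
  have hn₂ : ∀ i, 0 ≤ q i * x i ^ 2 := fun i => mul_nonneg (hq i) (sq_nonneg _)
  have hs₁ := Finset.sum_nonneg fun i (_ : i ∈ Finset.univ) => hn₁ i
  have hs₂ := Finset.sum_nonneg fun i (_ : i ∈ Finset.univ) => hn₂ i
  have hz₁ : ∀ i j, G.w i j * (x i - x j) ^ 2 = 0 := fun i j => by
    have h := (Finset.sum_eq_zero_iff_of_nonneg fun i _ => hn₁ i).1
      (show ∑ i, ∑ j, G.w i j * (x i - x j) ^ 2 = 0 by linarith) i (Finset.mem_univ i)
    exact (Finset.sum_eq_zero_iff_of_nonneg fun j _ =>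
      mul_nonneg (G.w_nonneg i j) (sq_nonneg _)).1 h j (Finset.mem_univ j)
  have hz₂ : ∀ i, q i * x i ^ 2 = 0 := fun i =>
    (Finset.sum_eq_zero_iff_of_nonneg fun i _ => hn₂ i).1
      (show ∑ i, q i * x i ^ 2 = 0 by linarith) i (Finset.mem_univ i)
  -- `a.elim 0 x` is the extension of `x` by `0` at `Γ`.
  have hadj : ∀ a b, (G.extend q hq).toSimpleGraph.Adj a b →
      a.elim (0 : ℝ) x = b.elim (0 : ℝ) x := by
    rintro (_ | i) (_ | j) ⟨-, h⟩
    · rfl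
    · have h : 0 < q j := h
      simpa [h.ne', eq_comm] using hz₂ j
    · have h : 0 < q i := h
      simpa [h.ne'] using hz₂ i
    · have h : 0 < G.w i j := h
      simpa [h.ne', sub_eq_zero] using hz₁ i j
  have hwalk : ∀ a b, (G.extend q hq).toSimpleGraph.Walk a b →
      a.elim (0 : ℝ) x = b.elim (0 : ℝ) x := by
    intro a b p
    induction p with
    | nil => rfl
    | cons h _ ih => exact (hadj _ _ h).trans ih
  ext i
  obtain ⟨p⟩ := hconn.preconnected (some i) none
  exact hwalk _ _ p

theorem kernelMatrix_mulVec_eq_iff (G : WeightedGraph V) (q x h : V → ℝ)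
    (hu : IsUnit (G.laplacian + Matrix.diagonal q)) :
    G.kernelMatrix q *ᵥ h = x ↔
      (G.laplacian + Matrix.diagonal q) *ᵥ x = Matrix.diagonal q *ᵥ h := by
  rw [Matrix.isUnit_iff_isUnit_det] at hu
  rw [kernelMatrix, ← Matrix.mulVec_mulVec]
  constructor
  · rintro rfl
    rw [Matrix.mulVec_mulVec, Matrix.mul_nonsing_inv _ hu, Matrix.one_mulVec]
  · intro e
    rw [← e, Matrix.mulVec_mulVec, Matrix.nonsing_inv_mul _ hu, Matrix.one_mulVec]

/-- Since `L 1 = 0`, `q = (L + Q) 1`; by symmetry `L + Q` moves onto `K h`, where it gives `Q h`. -/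
theorem dotProduct_kernelMatrix_mulVec (G : WeightedGraph V) (q h : V → ℝ)
    (hu : IsUnit (G.laplacian + Matrix.diagonal q)) :
    q ⬝ᵥ (G.kernelMatrix q *ᵥ h) = q ⬝ᵥ h := by
  have hone : G.laplacian *ᵥ 1 = 0 := by
    have := laplacian_add_diagonal_mulVec G 0 1
    ext i
    simpa using this i
  have hq : q = (G.laplacian + Matrix.diagonal q) *ᵥ 1 := by
    rw [Matrix.add_mulVec, hone, zero_add]
    ext i
    simp [Matrix.mulVec_diagonal]
  have hK := (kernelMatrix_mulVec_eq_iff G q _ h hu).1 rfl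
  nth_rw 1 [hq]
  rw [← transpose_laplacian_add_diagonal, Matrix.mulVec_transpose, ← Matrix.dotProduct_mulVec, hK]
  simp [dotProduct, Matrix.mulVec_diagonal]

/-! ### The expectation of a function of the root. -/

namespace IsRandomSpanningForest

variable {Ω : Type*} [MeasurableSpace Ω] {μ : Measure Ω} [IsProbabilityMeasure μ]
  {G : WeightedGraph V} {q : V → ℝ} {Φ : Ω → G.RootedSpanningForest}

theorem integral_rootOf (hΦ : G.IsRandomSpanningForest q Φ μ)
    (hu : IsUnit (G.laplacian + Matrix.diagonal q)) (h : V → ℝ) (i : V) :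
    ∫ ω, h ((Φ ω).rootOf i) ∂μ = (G.kernelMatrix q *ᵥ h) i := by
  obtain ⟨c, hc⟩ := hΦ.law
  have hint : ∀ g : G.RootedSpanningForest → ℝ,
      ∫ ω, g (Φ ω) ∂μ = c * ∑ φ : G.RootedSpanningForest, φ.weight q * g φ := by
    intro g
    have := Measure.isProbabilityMeasure_map (μ := μ) hΦ.measurable.aemeasurable
    rw [← integral_map (f := g) hΦ.measurable.aemeasurable
      (measurable_from_top (f := g)).aestronglyMeasurable,
      integral_fintype (memLp_one_iff_integrable.1 MemLp.of_discrete), Finset.mul_sum]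
    refine Finset.sum_congr rfl fun φ _ => ?_
    rw [map_measureReal_apply hΦ.measurable trivial, hc, smul_eq_mul, mul_assoc]
  -- Total probability one fixes `c` and shows that the total weight is nonzero.
  have hZ : c * ∑ φ : G.RootedSpanningForest, φ.weight q = 1 := by
    simpa using (hint fun _ => 1).symm
  have hK : G.kernelMatrix q *ᵥ h = fun i => ∫ ω, h ((Φ ω).rootOf i) ∂μ := by
    rw [kernelMatrix_mulVec_eq_iff G q _ h hu]
    ext i
    rw [laplacian_add_diagonal_mulVec, Matrix.mulVec_diagonal]
    simp only [fun k => hint fun φ => h (φ.rootOf k)]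
    have key := RootedSpanningForest.sum_weight_mul_rootOf_eq (G := G) q h i
    have hc : ∑ k, G.w i k * (c * ∑ φ : G.RootedSpanningForest, φ.weight q * h (φ.rootOf k))
        = c * ∑ k, G.w i k * ∑ φ : G.RootedSpanningForest, φ.weight q * h (φ.rootOf k) := by
      rw [Finset.mul_sum]
      exact Finset.sum_congr rfl fun k _ => mul_left_comm _ _ _
    rw [hc]
    -- `hZ` normalizes the boundary term `q i * h i`, the only one carrying the bare total weight.
    linear_combination c * key + q i * h i * hZ
  rw [hK]

end IsRandomSpanningForest

end WeightedGraph

/-! ### Bias and weighted error. -/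

theorem weightedNormSq_eq_sum {V : Type*} [Fintype V] [DecidableEq V] (q x : V → ℝ) :
    weightedNormSq q x = ∑ i, q i * x i ^ 2 := by
  simp only [weightedNormSq, dotProduct, Matrix.mulVec_diagonal]
  exact Finset.sum_congr rfl fun i _ => by ring

theorem proposition1 {V : Type*} [Fintype V] [DecidableEq V]
    (G : WeightedGraph V) (q : V → ℝ) (hq : ∀ i, 0 ≤ q i)
    (hconn : (G.extend q hq).toSimpleGraph.Connected) (y : V → ℝ)
    {Ω : Type*} [MeasurableSpace Ω] (μ : Measure Ω) [IsProbabilityMeasure μ]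
    (Φ : Ω → G.RootedSpanningForest) (hΦ : G.IsRandomSpanningForest q Φ μ) :
    -- the matrix inverse, the expectations and the variances are well defined
    IsUnit (G.laplacian + Matrix.diagonal q) ∧
    (∀ i, MemLp (fun ω => WeightedGraph.xTilde y (Φ ω) i) 2 μ) ∧
    -- unbiasedness
    (∫ ω, WeightedGraph.xTilde y (Φ ω) ∂μ) = G.xHat q y ∧
    -- weighted expected error
    (∫ ω, weightedNormSq q (G.xHat q y - WeightedGraph.xTilde y (Φ ω)) ∂μ)
      = ∑ i, q i * variance (fun ω => WeightedGraph.xTilde y (Φ ω) i) μ ∧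
    ∑ i, q i * variance (fun ω => WeightedGraph.xTilde y (Φ ω) i) μ
      = y ⬝ᵥ ((Matrix.diagonal q - (G.kernelMatrix q)ᵀ * Matrix.diagonal q * G.kernelMatrix q)
          *ᵥ y) := by
  have hu := G.isUnit_laplacian_add_diagonal q hq hconn
  have hL : ∀ i, MemLp (fun ω => WeightedGraph.xTilde y (Φ ω) i) 2 μ := fun i =>
    hΦ.memLp_comp (fun φ => WeightedGraph.xTilde y φ i) 2
  have hmean : ∀ i, ∫ ω, WeightedGraph.xTilde y (Φ ω) i ∂μ = G.xHat q y i := fun i =>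
    hΦ.integral_rootOf hu y i
  refine ⟨hu, hL, ?_, ?_, ?_⟩
  · ext i
    rw [eval_integral fun i => (hL i).integrable one_le_two, hmean]
  · simp only [weightedNormSq_eq_sum]
    rw [integral_finsetSum _ fun i _ => (hΦ.memLp_comp (fun φ =>
      q i * (G.xHat q y - WeightedGraph.xTilde y φ) i ^ 2) 1).integrable le_rfl]
    refine Finset.sum_congr rfl fun i _ => ?_
    rw [integral_const_mul, variance_eq_integral (hL i).aemeasurable, hmean]
    simp only [Pi.sub_apply, sub_sq_comm (G.xHat q y i)]
  -- The square of `y` at the root is the function `y²` at the root, so the mean formula also gives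
  -- the second moment.
  · have hsq : ∀ i, ∫ ω, WeightedGraph.xTilde y (Φ ω) i ^ 2 ∂μ
        = (G.kernelMatrix q *ᵥ fun j => y j ^ 2) i := fun i =>
      hΦ.integral_rootOf hu (fun j => y j ^ 2) i
    have hcol := G.dotProduct_kernelMatrix_mulVec q (fun j => y j ^ 2) hu
    have hvar : ∀ i, variance (fun ω => WeightedGraph.xTilde y (Φ ω) i) μ
        = (G.kernelMatrix q *ᵥ fun j => y j ^ 2) i - G.xHat q y i ^ 2 := fun i => by
      rw [variance_eq_sub (hL i), hmean, ← hsq]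
      rfl
    have hQ : y ⬝ᵥ (Matrix.diagonal q *ᵥ y) = ∑ i, q i * y i ^ 2 := weightedNormSq_eq_sum q y
    have hK : y ⬝ᵥ (((G.kernelMatrix q)ᵀ * Matrix.diagonal q * G.kernelMatrix q) *ᵥ y)
        = ∑ i, q i * G.xHat q y i ^ 2 := by
      rw [← weightedNormSq_eq_sum, weightedNormSq, ← Matrix.mulVec_mulVec, ← Matrix.mulVec_mulVec,
        Matrix.dotProduct_mulVec, Matrix.vecMul_transpose]
      rfl
    rw [Matrix.sub_mulVec, dotProduct_sub, hQ, hK, ← Finset.sum_sub_distrib]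
    simp only [hvar, mul_sub, Finset.sum_sub_distrib]
    -- The terms in `x̂²` agree on both sides; what remains is `qᵀ K = qᵀ` applied to `y²`.
    rw [sub_left_inj]
    exact hcol
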